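/- All Hilbert spaces are finite-dimensional, $\log=\log_2$, $\|A\|_1=\operatorname{tr}\sqrt{AA^\dagger}$, and a state is a positive semidefinite operator of unit trace. Put $S_0(\rho)=\log\operatorname{rank}\rho$, $S_2(\rho)=-\log\operatorname{tr}\rho^2$, and $S_\infty(P)=-\log\max_a P(a)$ for a probability distribution $P$. A classical-quantum (cq) state on $XA$ is a state of the form $\sum_x P(x)\,|x\rangle\langle x|\otimes\rho_A^x$ with $P$ a probability distribution and each $\rho_A^x$ a state, where $\{|x\rangle\}$ is a fixed orthonormal basis. For $\varepsilon\ge 0$ let $\mathcal B_{cq}^{\varepsilon}(\rho_{XA})$ be the set of cq states $\sigma_{XA}$ (possibly with another classical distribution) such that $\frac12\|\sigma_{XA}-\rho_{XA}\|_1\le\varepsilon$. **Theorem.** Let $n,\ell\in\mathbb N$ and let $\rho_{X^nE^n}=\sum_{x}P_{X^n}(x)\,|x\rangle\langle x|\otimes\rho_{E^n}^x$, $x\in\{0,1\}^n$, be the cq state describing Alice's bit string $X^n$ and Eve's quantum system $E^n$. Let a one-way error-correction protocol publicly send a transcript $C$ from a finite set $\mathcal C$, distributed according to $P_{C|X^n=x}$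 when Alice's string is $x$, so that the state after error correction is $$\rho_{X^nE^nC}=\sum_{x}P_{X^n}(x)\,|x\rangle\langle x|\otimes\rho_{E^n}^x\otimes\sum_{c}P_{C|X^n=x}(c)\,|c\rangle\langle c| ,$$ and define the leakage by $$\mathrm{leak}_{EC}=\log|\mathcal C|-\inf_{x\in\{0,1\}^n}S_\infty(P_{C|X^n=x}).$$ Let $(\mathcal F,P_F)$ be a finite two-universal family of functions $f:\{0,1\}^n\to\{0,1\}^\ell$, that is, for $f$ drawn from the distribution $P_F$, $\Pr_f[f(x)=f(x')]\le 2^{-\ell}$ for all $x\ne x'$. The key is $K=F(X^n)$, and $C$ and $F$ are known to Eve, so that the final state is $$\rho_{KE^nCF}=\sum_{f}P_F(f)\sum_{x}P_{X^n}(x)\,|f(x)\rangle\langle f(x)|\otimes\rho_{E^n}^x\otimes\sum_c P_{C|X^n=x}(c)\,|c\rangle\langle c|\otimes|f\rangle\langle f| .$$ Let $\bar\varepsilon,\varepsilon_{PA}\ge 0$. If $$\ell\le\sup_{\sigma_{X^nE^n}\in\mathcal B_{cq}^{\bar\varepsilon/2}(\rho_{X^nE^n})}\bigl(S_2(\sigma_{X^nE^n})-S_0(\sigma_{E^n})\bigr)-\mathrm{leak}_{EC}+2\log(2\varepsilon_{PA}),$$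 where $\log 0=-\infty$, then the key is $(\bar\varepsilon+\varepsilon_{PA})$-secure, that is, $$\tfrac12\bigl\|\rho_{KE^nCF}-2^{-\ell}\,\mathbb 1\otimes\rho_{E^nCF}\bigr\|_1\le\bar\varepsilon+\varepsilon_{PA}.$$ -/

import Mathlib

open scoped Matrix Kronecker ComplexOrder

noncomputable section

namespace QKD

/-- A classical probability distribution on a finite set. -/
def IsProb {α : Type*} [Fintype α] (P : α → ℝ) : Prop :=
  (∀ a, 0 ≤ P a) ∧ ∑ a, P a = 1

/-- A quantum state (density matrix): positive semidefinite with unit trace. -/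
def IsState {H : Type*} [Fintype H] (ρ : Matrix H H ℂ) : Prop :=
  ρ.PosSemidef ∧ ρ.trace = 1

/-- The trace norm `‖A‖₁ = tr √(A A†)`. -/
def traceNorm {H : Type*} [Fintype H] [DecidableEq H] (A : Matrix H H ℂ) : ℝ :=
  (cfc Real.sqrt (A * Aᴴ)).trace.re

/-- The trace distance `½ ‖ρ - σ‖₁`. -/
def traceDist {H : Type*} [Fintype H] [DecidableEq H] (ρ σ : Matrix H H ℂ) : ℝ :=
  (1 / 2) * traceNorm (ρ - σ)

/-- The partial trace over the first system. -/
def traceFst {A B : Type*} [Fintype A] (ρ : Matrix (A × B) (A × B) ℂ) : Matrix B B ℂ :=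
  Matrix.of fun i j => ∑ a, ρ (a, i) (a, j)

/-- The projector `|a⟩⟨a|` on a vector of the standard basis. -/
def proj {A : Type*} [DecidableEq A] (a : A) : Matrix A A ℂ :=
  Matrix.single a a 1

/-- A classical-quantum state `∑ₓ P(x) |x⟩⟨x| ⊗ ρˣ`, with `P` a probability distribution and
every `ρˣ` a state. -/
def IsCQ {X A : Type*} [Fintype X] [DecidableEq X] [Fintype A]
    (ρ : Matrix (X × A) (X × A) ℂ) : Prop :=
  ∃ (P : X → ℝ) (τ : X → Matrix A A ℂ), IsProb P ∧ (∀ x, IsState (τ x)) ∧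
    ρ = ∑ x, (P x : ℂ) • (proj x ⊗ₖ τ x)

/-- The classical-quantum `ε`-environment of `ρ` in trace distance. The distribution of the
classical part may differ from that of `ρ`. -/
def cqBall {X A : Type*} [Fintype X] [DecidableEq X] [Fintype A] [DecidableEq A]
    (ε : ℝ) (ρ : Matrix (X × A) (X × A) ℂ) : Set (Matrix (X × A) (X × A) ℂ) :=
  {σ | IsState σ ∧ IsCQ σ ∧ traceDist σ ρ ≤ ε}

/-- The Rényi entropy of order zero, `log₂ rank ρ`. -/
def S0 {H : Type*} [Fintype H] (ρ : Matrix H H ℂ) : ℝ :=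
  Real.logb 2 (ρ.rank : ℝ)

/-- The Rényi entropy of order two, `-log₂ tr ρ²`. -/
def S2 {H : Type*} [Fintype H] (ρ : Matrix H H ℂ) : ℝ :=
  -Real.logb 2 (ρ * ρ).trace.re

/-- The Rényi entropy of order infinity of a classical distribution, `-log₂ max P`. -/
def SInfty {α : Type*} (P : α → ℝ) : ℝ :=
  -Real.logb 2 (⨆ a, P a)

/-- The error-correction leakage `log₂ |C| - inf_x S_∞(P_{C|X=x})` of the one-way protocol
whose transcript, when the string is `x`, has the distribution `W x`. -/
def leak {X C : Type*} [Fintype C] (W : X → C → ℝ) : ℝ :=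
  Real.logb 2 (Fintype.card C : ℝ) - ⨅ x, SInfty (W x)

/-- The block `⟨x| ρ |x⟩`; for `ρ = ∑ₓ P(x) |x⟩⟨x| ⊗ ρˣ` it is `P(x) ρˣ`. -/
def block {X A : Type*} (ρ : Matrix (X × A) (X × A) ℂ) (x : X) : Matrix A A ℂ :=
  Matrix.of fun i j => ρ (x, i) (x, j)

/-- The state after error correction, with Eve's side information extended by the transcript:
`∑ₓ P(x) |x⟩⟨x| ⊗ ρˣ ⊗ ∑_c W(c|x) |c⟩⟨c|`. -/
def withTranscript {X E C : Type*} [Fintype X] [DecidableEq X] [Fintype C] [DecidableEq C]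
    (W : X → C → ℝ) (ρ : Matrix (X × E) (X × E) ℂ) :
    Matrix (X × (E × C)) (X × (E × C)) ℂ :=
  ∑ x, proj x ⊗ₖ (block ρ x ⊗ₖ ∑ c, (W x c : ℂ) • proj c)

/-- The state after privacy amplification: the hash function `h f`, with `f` drawn from `P`, is
applied to the classical part, and `f` is given to Eve. For `ρ = ∑ₓ P(x) |x⟩⟨x| ⊗ ρˣ` this is
`∑_f P(f) ∑ₓ P(x) |h f x⟩⟨h f x| ⊗ ρˣ ⊗ |f⟩⟨f|`. -/
def hashState {X Z A F : Type*} [Fintype X] [DecidableEq Z] [Fintype F] [DecidableEq F]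
    (P : F → ℝ) (h : F → X → Z) (ρ : Matrix (X × A) (X × A) ℂ) :
    Matrix (Z × (A × F)) (Z × (A × F)) ℂ :=
  ∑ f, (P f : ℂ) • ∑ x, proj (h f x) ⊗ₖ (block ρ x ⊗ₖ proj f)

/-- A family of functions `h f`, with `f` drawn from the distribution `P`, is two-universal if
any two distinct inputs collide with probability at most `1 / |Z|`. -/
def IsTwoUniversal {F X Z : Type*} [Fintype F] [Fintype Z] [DecidableEq Z]
    (P : F → ℝ) (h : F → X → Z) : Prop :=
  IsProb P ∧ ∀ x x' : X, x ≠ x' →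
    ∑ f with h f x = h f x', P f ≤ 1 / (Fintype.card Z : ℝ)

/-- The classical-quantum state `ρ` of an `ℓ`-bit key and an eavesdropper is `ε`-secure if
`½ ‖ρ_{KE} - 2^{-ℓ} 1 ⊗ ρ_E‖₁ ≤ ε`. -/
def IsSecure {ℓ : ℕ} {A : Type*} [Fintype A] [DecidableEq A] (ε : ℝ)
    (ρ : Matrix ((Fin ℓ → Bool) × A) ((Fin ℓ → Bool) × A) ℂ) : Prop :=
  traceDist ρ (((1 / 2 ^ ℓ : ℂ) • (1 : Matrix (Fin ℓ → Bool) (Fin ℓ → Bool) ℂ)) ⊗ₖ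
    traceFst ρ) ≤ ε

/-- The binary logarithm of a nonnegative real, with `log₂ 0 = -∞`. -/
def log2 (x : ℝ) : EReal :=
  if x ≤ 0 then ⊥ else ((Real.logb 2 x : ℝ) : EReal)

end QKD

end

/-! The proof is a leftover hash estimate in which the transcript `C` is carried along explicitly,
so no chain rule for smooth entropies is needed. The deviation of the final state from an ideal key
is block diagonal in (key z, transcript c, hash f). Its block is P(f) times `devBlock`, which is
linear in the initial state with coefficients W(c|x)(1[f(x)=z] - 1/|Z|).

Split ρ = σ + (ρ - σ) with σ in the ball. The difference is bounded crudely in trace norm: summing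
the absolute coefficients over z, c and f gives at most 2 for each x, and pinching gives at most 2‖ρ
- σ‖₁ in total (`sum_traceNorm_devBlock_le`, `sum_traceNorm_block_le`). Halved in the trace
distance, this is εbar for a ball of radius εbar/2.

For σ, pass to the Hilbert-Schmidt norm: ‖D‖₁² ≤ rank D · tr D², with rank D ≤ rank σ_E
(`rank_devBlock_le`). Averaging tr D² over f, two-universality removes the terms x ≠ x', and the
diagonal carries ∑_c W(c|x)² ≤ max W (`sum_trace_devBlock_sq_le`). Cauchy-Schwarz over the blocks
costs |Z||C|. Altogether the square is at most |Z| · |C| max W · rank σ_E · tr σ², whose logarithm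
is ℓ + leak + S₀(σ_E) - S₂(σ). -/

namespace QKD

open Matrix

/-! ### Trace norm of Hermitian matrices: duality, blocks and rank -/

section TraceNorm

variable {H : Type*} [Fintype H] [DecidableEq H]

/-- A Hermitian matrix `B` with `-1 ≤ B ≤ 1`. -/
def IsHermContraction (B : Matrix H H ℂ) : Prop :=
  (1 - B).PosSemidef ∧ (1 + B).PosSemidef

lemma trace_cfc {A : Matrix H H ℂ} (hA : A.IsHermitian) (f : ℝ → ℝ) :
    (cfc f A).trace = ∑ i, (f (hA.eigenvalues i) : ℂ) := by
  rw [hA.cfc_eq, IsHermitian.cfc, Unitary.conjStarAlgAut_apply, trace_mul_cycle,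
    Unitary.coe_star_mul_self, one_mul, trace_diagonal]
  rfl

lemma traceNorm_eq_sum_abs_eigenvalues {A : Matrix H H ℂ} (hA : A.IsHermitian) :
    traceNorm A = ∑ i, |hA.eigenvalues i| := by
  have hA' : IsSelfAdjoint A := hA
  rw [traceNorm, hA.eq, ← pow_two, ← cfc_comp_pow Real.sqrt 2 A, trace_cfc hA]
  simp [Real.sqrt_sq_eq_abs]

lemma trace_sq_eq_sum_sq_eigenvalues {A : Matrix H H ℂ} (hA : A.IsHermitian) :
    (A * A).trace.re = ∑ i, hA.eigenvalues i ^ 2 := by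
  have hA' : IsSelfAdjoint A := hA
  have h : A * A = cfc (fun x : ℝ => x ^ 2) A := by
    rw [cfc_pow_id A 2, pow_two]
  rw [h, trace_cfc hA]
  simp only [← Complex.ofReal_sum, Complex.ofReal_re]

lemma re_trace_mul_eq {A : Matrix H H ℂ} (hA : A.IsHermitian) (B : Matrix H H ℂ) :
    (A * B).trace.re = ∑ i, hA.eigenvalues i *
      (((hA.eigenvectorUnitary : Matrix H H ℂ)ᴴ * B * hA.eigenvectorUnitary) i i).re := by
  set U : Matrix H H ℂ := (hA.eigenvectorUnitary : Matrix H H ℂ)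
  have h : (A * B).trace
      = (diagonal (fun i => (hA.eigenvalues i : ℂ)) * (Uᴴ * B * U)).trace := by
    conv_lhs => rw [hA.spectral_theorem, Unitary.conjStarAlgAut_apply]
    rw [mul_assoc, mul_assoc, trace_mul_comm]
    simp only [mul_assoc]
    rfl
  rw [h, trace]
  simp [diagonal_mul]

/-- In an eigenbasis of `A` only the diagonal of `B` enters the trace, and `-1 ≤ B ≤ 1` confines
that diagonal to [-1, 1]. -/
lemma re_trace_mul_le_traceNorm {A B : Matrix H H ℂ} (hA : A.IsHermitian)
    (hB : IsHermContraction B) : (A * B).trace.re ≤ traceNorm A := by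
  rw [re_trace_mul_eq hA, traceNorm_eq_sum_abs_eigenvalues hA]
  refine Finset.sum_le_sum fun i _ => ?_
  set U : Matrix H H ℂ := (hA.eigenvectorUnitary : Matrix H H ℂ) with hU
  have hUU : Uᴴ * U = 1 := Unitary.coe_star_mul_self hA.eigenvectorUnitary
  have h1 := (hB.1.conjTranspose_mul_mul_same U).diag_nonneg (i := i)
  have h2 := (hB.2.conjTranspose_mul_mul_same U).diag_nonneg (i := i)
  rw [mul_sub, sub_mul, mul_one, hUU] at h1
  rw [mul_add, add_mul, mul_one, hUU] at h2
  have h1' := (Complex.le_def.1 h1).1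
  have h2' := (Complex.le_def.1 h2).1
  simp only [Matrix.sub_apply, Matrix.add_apply, one_apply_eq, Complex.sub_re, Complex.add_re,
    Complex.one_re, Complex.zero_re] at h1' h2'
  have h3 : |((Uᴴ * B * U) i i).re| ≤ 1 := abs_le.2 ⟨by linarith, by linarith⟩
  calc _ ≤ |hA.eigenvalues i * ((Uᴴ * B * U) i i).re| := le_abs_self _
    _ = |hA.eigenvalues i| * |((Uᴴ * B * U) i i).re| := abs_mul _ _
    _ ≤ _ := mul_le_of_le_one_right (abs_nonneg _) h3

/-- The optimal `B` is the sign of `A`, taken in its eigenbasis, with sign 1 on the kernel. -/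
lemma exists_re_trace_mul_eq_traceNorm {A : Matrix H H ℂ} (hA : A.IsHermitian) :
    ∃ B : Matrix H H ℂ, IsHermContraction B ∧ (A * B).trace.re = traceNorm A := by
  set U : Matrix H H ℂ := (hA.eigenvectorUnitary : Matrix H H ℂ) with hU
  have hUU : Uᴴ * U = 1 := Unitary.coe_star_mul_self hA.eigenvectorUnitary
  have hUU' : U * Uᴴ = 1 := Unitary.coe_mul_star_self hA.eigenvectorUnitary
  set s : H → ℝ := fun i => if hA.eigenvalues i < 0 then -1 else 1 with hs
  set S : Matrix H H ℂ := diagonal fun i => (s i : ℂ) with hS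
  have e (c : ℂ) : 1 + c • (U * S * Uᴴ) = U * (diagonal fun i => 1 + c * (s i : ℂ)) * Uᴴ := by
    have : (diagonal fun i => 1 + c * (s i : ℂ)) = 1 + c • S := by
      rw [hS, ← diagonal_one, ← diagonal_smul, diagonal_add]
      rfl
    rw [this, mul_add, add_mul, mul_one, hUU', mul_smul_comm, smul_mul_assoc]
  refine ⟨U * S * Uᴴ, ⟨?_, ?_⟩, ?_⟩
  · have := e (-1)
    rw [neg_one_smul, ← sub_eq_add_neg] at this
    rw [this]
    refine PosSemidef.mul_mul_conjTranspose_same (PosSemidef.diagonal fun i => ?_) U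
    simp only [hs, Pi.zero_apply]
    split_ifs <;> norm_num
  · have := e 1
    rw [one_smul] at this
    rw [this]
    refine PosSemidef.mul_mul_conjTranspose_same (PosSemidef.diagonal fun i => ?_) U
    simp only [hs, Pi.zero_apply]
    split_ifs <;> norm_num
  · rw [re_trace_mul_eq hA, traceNorm_eq_sum_abs_eigenvalues hA]
    refine Finset.sum_congr rfl fun i _ => ?_
    have h : (hA.eigenvectorUnitary : Matrix H H ℂ)ᴴ * (U * S * Uᴴ) * hA.eigenvectorUnitary
        = S := by
      change Uᴴ * (U * S * Uᴴ) * U = S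
      calc _ = (Uᴴ * U) * S * (Uᴴ * U) := by simp only [mul_assoc]
        _ = S := by rw [hUU, one_mul, mul_one]
    rw [h, hS, diagonal_apply_eq, Complex.ofReal_re, hs]
    dsimp only
    split_ifs with h0
    · rw [abs_of_neg h0]; ring
    · rw [abs_of_nonneg (not_lt.1 h0)]; ring

/-- Duality turns the trace norm into a maximum of linear functionals, so subadditivity and the
block estimates below need no further spectral theory. -/
lemma traceNorm_le_iff {A : Matrix H H ℂ} (hA : A.IsHermitian) {t : ℝ} :
    traceNorm A ≤ t ↔ ∀ B, IsHermContraction B → (A * B).trace.re ≤ t := by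
  refine ⟨fun h B hB => (re_trace_mul_le_traceNorm hA hB).trans h, fun h => ?_⟩
  obtain ⟨B, hB, e⟩ := exists_re_trace_mul_eq_traceNorm hA
  exact e ▸ h B hB

omit [Fintype H] in
lemma IsHermContraction.neg {B : Matrix H H ℂ} (hB : IsHermContraction B) :
    IsHermContraction (-B) :=
  ⟨by simpa using hB.2, by simpa [sub_eq_add_neg] using hB.1⟩

omit [Fintype H] in
lemma IsHermContraction.submatrix {G : Type*} [DecidableEq G] {B : Matrix H H ℂ}
    (hB : IsHermContraction B) {e : G → H} (he : Function.Injective e) :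
    IsHermContraction (B.submatrix e e) := by
  constructor
  · simpa [submatrix_sub, submatrix_one e he] using hB.1.submatrix e
  · simpa [submatrix_add, submatrix_one e he] using hB.2.submatrix e

lemma traceNorm_nonneg {A : Matrix H H ℂ} (hA : A.IsHermitian) : 0 ≤ traceNorm A := by
  rw [traceNorm_eq_sum_abs_eigenvalues hA]
  exact Finset.sum_nonneg fun _ _ => abs_nonneg _

lemma traceNorm_zero : traceNorm (0 : Matrix H H ℂ) = 0 :=
  le_antisymm ((traceNorm_le_iff isHermitian_zero).2 fun B _ => by simp)
    (traceNorm_nonneg isHermitian_zero)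

lemma traceNorm_add_le {A B : Matrix H H ℂ} (hA : A.IsHermitian) (hB : B.IsHermitian) :
    traceNorm (A + B) ≤ traceNorm A + traceNorm B := by
  rw [traceNorm_le_iff (hA.add hB)]
  intro T hT
  rw [add_mul, trace_add, Complex.add_re]
  exact add_le_add (re_trace_mul_le_traceNorm hA hT) (re_trace_mul_le_traceNorm hB hT)

omit [Fintype H] [DecidableEq H] in
lemma isHermitian_sum {ι : Type*} (s : Finset ι) {A : ι → Matrix H H ℂ}
    (hA : ∀ i, (A i).IsHermitian) : (∑ i ∈ s, A i).IsHermitian := by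
  simp only [IsHermitian, conjTranspose_sum, (hA _).eq]

omit [Fintype H] [DecidableEq H] in
lemma isHermitian_ofReal_smul {A : Matrix H H ℂ} (hA : A.IsHermitian) (c : ℝ) :
    ((c : ℂ) • A).IsHermitian := by
  simp [IsHermitian, conjTranspose_smul, hA.eq]

lemma traceNorm_sum_le {ι : Type*} (s : Finset ι) {A : ι → Matrix H H ℂ}
    (hA : ∀ i, (A i).IsHermitian) : traceNorm (∑ i ∈ s, A i) ≤ ∑ i ∈ s, traceNorm (A i) := by
  classical
  induction s using Finset.induction_on with
  | empty => simp [traceNorm_zero]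
  | insert a s ha ih =>
    rw [Finset.sum_insert ha, Finset.sum_insert ha]
    exact (traceNorm_add_le (hA a) (isHermitian_sum s hA)).trans (by gcongr)

lemma traceNorm_smul_le {A : Matrix H H ℂ} (hA : A.IsHermitian) (c : ℝ) :
    traceNorm ((c : ℂ) • A) ≤ |c| * traceNorm A := by
  rw [traceNorm_le_iff (isHermitian_ofReal_smul hA c)]
  intro B hB
  rw [smul_mul_assoc, trace_smul, smul_eq_mul, Complex.re_ofReal_mul]
  rcases le_total 0 c with h | h
  · rw [abs_of_nonneg h]
    exact mul_le_mul_of_nonneg_left (re_trace_mul_le_traceNorm hA hB) h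
  · have := re_trace_mul_le_traceNorm hA hB.neg
    rw [mul_neg, trace_neg, Complex.neg_re] at this
    rw [abs_of_nonpos h]
    nlinarith

lemma traceNorm_neg {A : Matrix H H ℂ} (hA : A.IsHermitian) : traceNorm (-A) = traceNorm A := by
  have h1 := traceNorm_smul_le hA (-1)
  have h2 := traceNorm_smul_le hA.neg (-1)
  simp at h1 h2
  exact le_antisymm h1 h2

/-- The trace norm of a block-diagonal matrix, whose index type is identified with pairs of a block
and an index inside the block, is at most the sum of the trace norms of its blocks. -/
lemma traceNorm_le_sum_blocks {I G : Type*} [Fintype I] [DecidableEq I] [Fintype G] [DecidableEq G]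
    {A : Matrix H H ℂ} (hA : A.IsHermitian) (e : I × G ≃ H)
    (h0 : ∀ i j a b, i ≠ j → A (e (i, a)) (e (j, b)) = 0) :
    traceNorm A ≤ ∑ i, traceNorm (A.submatrix (fun a => e (i, a)) fun a => e (i, a)) := by
  rw [traceNorm_le_iff hA]
  intro B hB
  -- Only the diagonal blocks of `B` are seen by a block-diagonal `A`, and they are again
  -- contractions.
  have h : (A * B).trace = ∑ i, ((A.submatrix (fun a => e (i, a)) fun a => e (i, a)) *
      (B.submatrix (fun a => e (i, a)) fun a => e (i, a))).trace := by
    simp only [trace, diag_apply, mul_apply, submatrix_apply, ← e.sum_comp, Fintype.sum_prod_type]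
    refine Finset.sum_congr rfl fun i _ => Finset.sum_congr rfl fun a _ => ?_
    rw [Finset.sum_eq_single i]
    · intro j _ hj
      exact Finset.sum_eq_zero fun b _ => by rw [h0 i j a b hj.symm, zero_mul]
    · simp
  rw [h, Complex.re_sum]
  refine Finset.sum_le_sum fun i _ => re_trace_mul_le_traceNorm (hA.submatrix _) ?_
  exact hB.submatrix fun a b hab => by simpa using e.injective hab

open scoped MatrixOrder in
lemma exists_eq_conjTranspose_mul_self {A : Matrix H H ℂ} (hA : A.PosSemidef) :
    ∃ M : Matrix H H ℂ, A = Mᴴ * M := by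
  obtain ⟨M, hM⟩ := CStarAlgebra.nonneg_iff_eq_star_mul_self.1 hA.nonneg
  exact ⟨M, hM⟩

lemma isHermitian_block {X A : Type*} {ρ : Matrix (X × A) (X × A) ℂ} (hρ : ρ.IsHermitian) (x : X) :
    (block ρ x).IsHermitian :=
  hρ.submatrix (Prod.mk x)

lemma posSemidef_block {X A : Type*} {ρ : Matrix (X × A) (X × A) ℂ}
    (hρ : ρ.PosSemidef) (x : X) : (block ρ x).PosSemidef :=
  hρ.submatrix (Prod.mk x)

/-- Pinching does not increase the trace norm. -/
lemma sum_traceNorm_block_le {X A : Type*} [Fintype X] [DecidableEq X] [Fintype A] [DecidableEq A]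
    {ρ : Matrix (X × A) (X × A) ℂ} (hρ : ρ.IsHermitian)
    (h0 : ∀ x y a b, x ≠ y → ρ (x, a) (y, b) = 0) :
    ∑ x, traceNorm (block ρ x) ≤ traceNorm ρ := by
  choose B hB e using fun x => exists_re_trace_mul_eq_traceNorm (isHermitian_block hρ x)
  have key (M : X → Matrix A A ℂ) (hM : ∀ x, (M x).PosSemidef) :
      (reindex (Equiv.prodComm A X) (Equiv.prodComm A X) (blockDiagonal M)).PosSemidef := by
    choose N hN using fun x => exists_eq_conjTranspose_mul_self (hM x)
    have : blockDiagonal M = (blockDiagonal N)ᴴ * blockDiagonal N := by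
      rw [blockDiagonal_conjTranspose, ← blockDiagonal_mul]
      congr 1
      funext x
      exact hN x
    rw [this]
    exact (posSemidef_conjTranspose_mul_self _).submatrix _
  -- The test matrix glues together the optimal test matrices of the blocks, so it attains all their
  -- trace norms at once.
  set T := reindex (Equiv.prodComm A X) (Equiv.prodComm A X) (blockDiagonal B) with hT
  have hone : reindex (Equiv.prodComm A X) (Equiv.prodComm A X)
      (blockDiagonal fun _ : X => (1 : Matrix A A ℂ)) = 1 := by
    rw [show (fun _ : X => (1 : Matrix A A ℂ)) = 1 from rfl, blockDiagonal_one]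
    exact submatrix_one_equiv _
  have hTc : IsHermContraction T := by
    constructor
    · have := key (fun x => 1 - B x) fun x => (hB x).1
      rw [show (fun x => 1 - B x) = (fun _ : X => (1 : Matrix A A ℂ)) - B from rfl,
        blockDiagonal_sub] at this
      rw [← hone, hT]
      exact this
    · have := key (fun x => 1 + B x) fun x => (hB x).2
      rw [show (fun x => 1 + B x) = (fun _ : X => (1 : Matrix A A ℂ)) + B from rfl,
        blockDiagonal_add] at this
      rw [← hone, hT]
      exact this
  refine le_of_eq_of_le ?_ (re_trace_mul_le_traceNorm hρ hTc)
  simp only [← e, ← Complex.re_sum]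
  congr 1
  simp only [trace, diag_apply, mul_apply, Fintype.sum_prod_type]
  refine Finset.sum_congr rfl fun x _ => Finset.sum_congr rfl fun a _ => ?_
  rw [Finset.sum_eq_single x]
  · simp [block, hT, blockDiagonal_apply]
  · intro y _ hy
    exact Finset.sum_eq_zero fun b _ => by rw [h0 x y a b hy.symm, zero_mul]
  · simp

/-- Cauchy-Schwarz over the nonzero eigenvalues only, whose number is the rank. -/
lemma traceNorm_le_sqrt_rank {A : Matrix H H ℂ} (hA : A.IsHermitian) :
    traceNorm A ≤ √(A.rank * (A * A).trace.re) := by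
  rw [trace_sq_eq_sum_sq_eigenvalues hA, traceNorm_eq_sum_abs_eigenvalues hA]
  apply Real.le_sqrt_of_sq_le
  have h1 : ∑ i, |hA.eigenvalues i| = ∑ i with hA.eigenvalues i ≠ 0, |hA.eigenvalues i| := by
    rw [Finset.sum_filter]
    refine Finset.sum_congr rfl fun i _ => ?_
    split_ifs with h
    · rfl
    · simp [not_not.1 h]
  have h2 : A.rank = Finset.card {i | hA.eigenvalues i ≠ 0} := by
    rw [hA.rank_eq_card_non_zero_eigs, Fintype.card_subtype]
  rw [h1, h2]
  refine sq_sum_le_card_mul_sum_sq.trans ?_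
  simp only [sq_abs]
  exact mul_le_mul_of_nonneg_left (Finset.sum_le_sum_of_subset_of_nonneg (Finset.filter_subset _ _)
    fun i _ _ => sq_nonneg (hA.eigenvalues i)) (Nat.cast_nonneg _)

lemma re_trace_mul_nonneg {A B : Matrix H H ℂ} (hA : A.PosSemidef) (hB : B.PosSemidef) :
    0 ≤ (A * B).trace.re := by
  obtain ⟨M, rfl⟩ := exists_eq_conjTranspose_mul_self hB
  rw [← mul_assoc, trace_mul_comm, ← mul_assoc]
  have h : 0 ≤ (M * A * Mᴴ).trace := (hA.mul_mul_conjTranspose_same M).trace_nonneg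
  exact (Complex.le_def.1 h).1

end TraceNorm

/-! ### Two-universal hashing with a public transcript -/

section Hash

variable {X Z E C F : Type*} [Fintype X] [DecidableEq X] [Fintype Z] [DecidableEq Z]
  [Fintype E] [DecidableEq E] [Fintype C] [DecidableEq C] [Fintype F] [DecidableEq F]

/-- The coefficient of `block ρ x` in the block of the state after privacy amplification that
belongs to the key `z`, the transcript `c` and the hash function `f`, relative to an ideal key. -/
noncomputable def devCoeff (W : X → C → ℝ) (h : F → X → Z) (f : F) (c : C) (z : Z) (x : X) : ℝ :=
  W x c * ((if h f x = z then 1 else 0) - 1 / Fintype.card Z)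

/-- The block of the deviation from an ideal key that belongs to the key `z`, the transcript `c`
and the hash function `f`. -/
noncomputable def devBlock (W : X → C → ℝ) (h : F → X → Z) (ρ : Matrix (X × E) (X × E) ℂ)
    (f : F) (c : C) (z : Z) : Matrix E E ℂ :=
  ∑ x, (devCoeff W h f c z x : ℂ) • block ρ x

omit [Fintype E] [DecidableEq E] [Fintype C] [DecidableEq C] [Fintype F] [DecidableEq F]
  [DecidableEq X] in
lemma isHermitian_devBlock (W : X → C → ℝ) (h : F → X → Z) {ρ : Matrix (X × E) (X × E) ℂ}
    (hρ : ρ.IsHermitian) (f : F) (c : C) (z : Z) : (devBlock W h ρ f c z).IsHermitian :=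
  isHermitian_sum _ fun x => isHermitian_ofReal_smul (isHermitian_block hρ x) _

omit [Fintype E] [DecidableEq E] in
lemma block_withTranscript (W : X → C → ℝ) (ρ : Matrix (X × E) (X × E) ℂ) (x : X) (a b : E)
    (c c' : C) : block (withTranscript W ρ) x (a, c) (b, c') =
      if c = c' then (W x c : ℂ) * ρ (x, a) (x, b) else 0 := by
  simp only [block, withTranscript, of_apply, Matrix.sum_apply, kroneckerMap_apply, proj,
    Matrix.smul_apply, single_apply, smul_eq_mul]
  rw [Finset.sum_eq_single x]
  · rw [Finset.sum_eq_single c]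
    · by_cases hc : c = c' <;> simp [hc, mul_comm]
    · intro d _ hd
      simp [hd]
    · simp
  · intro y _ hy
    simp [hy]
  · simp

omit [Fintype E] [DecidableEq E] [Fintype Z] in
lemma hashState_withTranscript_apply (P : F → ℝ) (h : F → X → Z) (W : X → C → ℝ)
    (ρ : Matrix (X × E) (X × E) ℂ) (z z' : Z) (a b : E) (c c' : C) (f f' : F) :
    hashState P h (withTranscript W ρ) (z, ((a, c), f)) (z', ((b, c'), f')) =
      if z = z' ∧ c = c' ∧ f = f' then
        (P f : ℂ) * ∑ x, if h f x = z then (W x c : ℂ) * ρ (x, a) (x, b) else 0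
      else 0 := by
  simp only [hashState, Matrix.sum_apply, Matrix.smul_apply, kroneckerMap_apply, proj,
    single_apply, smul_eq_mul, block_withTranscript]
  rw [Finset.sum_eq_single f]
  · by_cases hz : z = z' <;> by_cases hc : c = c' <;> by_cases hf : f = f' <;>
      simp [hz, hc, hf]
    exact Or.inr (Finset.sum_eq_zero fun x _ => if_neg fun hx => hz (hx.1.symm.trans hx.2))
  · intro g _ hg
    simp [hg]
  · simp

omit [Fintype E] [DecidableEq E] in
-- Tracing out the key sums the indicator of `h f x = z` over z to 1, so the ideal state contributes
-- the constant 1/|Z| in `devCoeff`.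
lemma hashState_sub_ideal_apply [Nonempty Z] (P : F → ℝ) (h : F → X → Z) (W : X → C → ℝ)
    (ρ : Matrix (X × E) (X × E) ℂ) (z z' : Z) (a b : E) (c c' : C) (f f' : F) :
    (hashState P h (withTranscript W ρ) - ((1 / Fintype.card Z : ℂ) • (1 : Matrix Z Z ℂ)) ⊗ₖ
      traceFst (hashState P h (withTranscript W ρ))) (z, ((a, c), f)) (z', ((b, c'), f')) =
      if z = z' ∧ c = c' ∧ f = f' then (P f : ℂ) * devBlock W h ρ f c z a b else 0 := by
  simp only [Matrix.sub_apply, kroneckerMap_apply, traceFst, of_apply,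
    hashState_withTranscript_apply, Matrix.smul_apply, one_apply, smul_eq_mul, true_and]
  by_cases hz : z = z'
  swap
  · simp [hz]
  by_cases hcf : c = c' ∧ f = f'
  swap
  · simp [hcf]
  simp only [hz, hcf, and_self, if_true, mul_one, devBlock, devCoeff, Matrix.sum_apply,
    Matrix.smul_apply, smul_eq_mul]
  rw [← Finset.mul_sum, Finset.sum_comm, mul_left_comm, ← mul_sub, Finset.mul_sum,
    ← Finset.sum_sub_distrib]
  congr 1
  refine Finset.sum_congr rfl fun x _ => ?_
  rw [Finset.sum_ite_eq, if_pos (Finset.mem_univ _)]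
  split_ifs <;> simp [block] <;> ring

lemma traceNorm_hashState_sub_ideal_le [Nonempty Z] {P : F → ℝ} (hP : ∀ f, 0 ≤ P f)
    (h : F → X → Z) (W : X → C → ℝ) {ρ : Matrix (X × E) (X × E) ℂ} (hρ : ρ.IsHermitian) :
    traceNorm (hashState P h (withTranscript W ρ) -
      ((1 / Fintype.card Z : ℂ) • (1 : Matrix Z Z ℂ)) ⊗ₖ
        traceFst (hashState P h (withTranscript W ρ))) ≤
      ∑ i : Z × C × F, P i.2.2 * traceNorm (devBlock W h ρ i.2.2 i.2.1 i.1) := by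
  set A := hashState P h (withTranscript W ρ) -
      ((1 / Fintype.card Z : ℂ) • (1 : Matrix Z Z ℂ)) ⊗ₖ
        traceFst (hashState P h (withTranscript W ρ)) with hA
  have hApp := hashState_sub_ideal_apply P h W ρ
  have hAH : A.IsHermitian := by
    ext ⟨z, ⟨a, c⟩, f⟩ ⟨z', ⟨b, c'⟩, f'⟩
    rw [conjTranspose_apply, hA, hApp, hApp]
    by_cases hz : z' = z ∧ c' = c ∧ f' = f
    · obtain ⟨rfl, rfl, rfl⟩ := hz
      have := (isHermitian_devBlock W h hρ f' c' z').apply a b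
      simp only [and_self, if_true, ← this, star_mul']
      simp
    · rw [if_neg hz, if_neg (fun ⟨h1, h2, h3⟩ => hz ⟨h1.symm, h2.symm, h3.symm⟩), star_zero]
  -- Regroups the indices so that the classical registers label the blocks and `E` is the space
  -- inside each block.
  let e : (Z × C × F) × E ≃ Z × ((E × C) × F) :=
    { toFun := fun i => (i.1.1, ((i.2, i.1.2.1), i.1.2.2))
      invFun := fun j => ((j.1, j.2.1.2, j.2.2), j.2.1.1)
      left_inv := fun _ => rfl
      right_inv := fun _ => rfl }
  refine (traceNorm_le_sum_blocks hAH e ?_).trans (Finset.sum_le_sum ?_)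
  · rintro ⟨z, c, f⟩ ⟨z', c', f'⟩ a b hij
    refine (hApp z z' a b c c' f f').trans (if_neg ?_)
    rintro ⟨rfl, rfl, rfl⟩
    exact hij rfl
  · rintro ⟨z, c, f⟩ _
    have : (A.submatrix (fun a => e ((z, c, f), a)) fun a => e ((z, c, f), a)) =
        (P f : ℂ) • devBlock W h ρ f c z := by
      ext a b
      exact (hApp z z a b c c f f).trans (if_pos ⟨rfl, rfl, rfl⟩)
    rw [this]
    refine (traceNorm_smul_le (isHermitian_devBlock W h hρ f c z) (P f)).trans_eq ?_
    rw [abs_of_nonneg (hP f)]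

omit [Fintype X] [DecidableEq X] [DecidableEq C] [Fintype F] [DecidableEq F] in
-- The indicator and the uniform distribution each have total mass 1 over the keys.
lemma sum_abs_devCoeff_le [Nonempty Z] {W : X → C → ℝ} (hW : ∀ x, IsProb (W x)) (h : F → X → Z)
    (f : F) (c : C) (x : X) : ∑ z, |devCoeff W h f c z x| ≤ 2 * W x c := by
  have hZ : (0 : ℝ) < Fintype.card Z := by exact_mod_cast Fintype.card_pos
  calc ∑ z, |devCoeff W h f c z x|
      ≤ ∑ z, W x c * ((if h f x = z then 1 else 0) + 1 / Fintype.card Z) := by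
        refine Finset.sum_le_sum fun z _ => ?_
        rw [devCoeff, abs_mul, abs_of_nonneg ((hW x).1 c)]
        refine mul_le_mul_of_nonneg_left ((abs_sub _ _).trans ?_) ((hW x).1 c)
        rw [abs_of_nonneg (by positivity : (0 : ℝ) ≤ 1 / Fintype.card Z)]
        split_ifs <;> simp
    _ = 2 * W x c := by
        rw [← Finset.mul_sum, Finset.sum_add_distrib, Finset.sum_ite_eq]
        simp [hZ.ne']
        ring

omit [DecidableEq X] [DecidableEq C] [DecidableEq F] in
-- Pays for smoothing. Two-universality plays no role and `δ` need not be positive; the factor 2 has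
-- one share from the real key and one from the ideal key.
lemma sum_traceNorm_devBlock_le [Nonempty Z] {P : F → ℝ} (hP : IsProb P) (h : F → X → Z)
    {W : X → C → ℝ} (hW : ∀ x, IsProb (W x)) {δ : Matrix (X × E) (X × E) ℂ} (hδ : δ.IsHermitian) :
    ∑ i : Z × C × F, P i.2.2 * traceNorm (devBlock W h δ i.2.2 i.2.1 i.1) ≤
      2 * ∑ x, traceNorm (block δ x) := by
  have hn (x : X) : 0 ≤ traceNorm (block δ x) := traceNorm_nonneg (isHermitian_block hδ x)
  calc ∑ i : Z × C × F, P i.2.2 * traceNorm (devBlock W h δ i.2.2 i.2.1 i.1)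
      ≤ ∑ i : Z × C × F, P i.2.2 *
          ∑ x, |devCoeff W h i.2.2 i.2.1 i.1 x| * traceNorm (block δ x) := by
        refine Finset.sum_le_sum fun i _ => mul_le_mul_of_nonneg_left ?_ (hP.1 _)
        refine (traceNorm_sum_le _ fun x =>
          isHermitian_ofReal_smul (isHermitian_block hδ x) _).trans ?_
        exact Finset.sum_le_sum fun x _ => traceNorm_smul_le (isHermitian_block hδ x) _
    _ = ∑ x, (∑ i : Z × C × F, P i.2.2 * |devCoeff W h i.2.2 i.2.1 i.1 x|) *
          traceNorm (block δ x) := by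
        simp only [Finset.mul_sum, Finset.sum_mul, mul_assoc]
        exact Finset.sum_comm
    _ ≤ ∑ x, 2 * traceNorm (block δ x) := by
        refine Finset.sum_le_sum fun x _ => mul_le_mul_of_nonneg_right ?_ (hn x)
        rw [Fintype.sum_prod_type, Finset.sum_comm]
        calc ∑ j : C × F, ∑ z, P j.2 * |devCoeff W h j.2 j.1 z x|
            ≤ ∑ j : C × F, P j.2 * (2 * W x j.1) := by
              refine Finset.sum_le_sum fun j _ => ?_
              rw [← Finset.mul_sum]
              exact mul_le_mul_of_nonneg_left (sum_abs_devCoeff_le hW h j.2 j.1 x) (hP.1 _)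
          _ = 2 := by
              rw [Fintype.sum_prod_type]
              simp only [← Finset.sum_mul, ← Finset.mul_sum, hP.2, (hW x).2]
              norm_num
    _ = _ := by rw [Finset.mul_sum]

/-- Inner product of two point masses after subtracting the uniform distribution from each. -/
lemma sum_indicator_sub_mul [Nonempty Z] (u v : Z) :
    ∑ z, ((if u = z then (1 : ℝ) else 0) - 1 / Fintype.card Z) *
      ((if v = z then 1 else 0) - 1 / Fintype.card Z) =
      (if u = v then 1 else 0) - 1 / Fintype.card Z := by
  have hZ : (Fintype.card Z : ℝ) ≠ 0 := by exact_mod_cast Fintype.card_ne_zero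
  have e (z : Z) : ((if u = z then (1 : ℝ) else 0) - 1 / Fintype.card Z) *
      ((if v = z then 1 else 0) - 1 / Fintype.card Z) =
      (if v = z then (if u = z then (1 : ℝ) else 0) else 0)
        - (1 / Fintype.card Z) * (if u = z then (1 : ℝ) else 0)
        - (1 / Fintype.card Z) * (if v = z then (1 : ℝ) else 0)
        + (1 / Fintype.card Z) * (1 / Fintype.card Z) := by
    split_ifs <;> ring
  simp only [e, Finset.sum_add_distrib, Finset.sum_sub_distrib, ← Finset.mul_sum,
    Finset.sum_ite_eq, Finset.mem_univ, if_true, Finset.sum_const, Finset.card_univ, nsmul_eq_mul]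
  field_simp
  ring

omit [Fintype X] [DecidableEq F] in
-- For x ≠ y the collision probability does not exceed 1/|Z|, so the excess is nonpositive; for x =
-- y it is 1 - 1/|Z|.
lemma sum_collision_sub_le [Nonempty Z] {P : F → ℝ} {h : F → X → Z} (hh : IsTwoUniversal P h)
    (x y : X) : ∑ f, P f * ((if h f x = h f y then 1 else 0) - 1 / Fintype.card Z) ≤
      if x = y then 1 else 0 := by
  have e : ∑ f, P f * ((if h f x = h f y then (1 : ℝ) else 0) - 1 / Fintype.card Z) =
      ∑ f with h f x = h f y, P f - 1 / Fintype.card Z := by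
    simp only [mul_sub, Finset.sum_sub_distrib, mul_ite, mul_one, mul_zero, Finset.sum_filter]
    rw [← Finset.sum_mul, hh.1.2, one_mul]
  rw [e]
  split_ifs with hxy
  · subst hxy
    have : (0 : ℝ) ≤ 1 / Fintype.card Z := by positivity
    simp only [Finset.filter_true, hh.1.2]
    linarith
  · linarith [hh.2 x y hxy]

omit [DecidableEq C] [DecidableEq F] in
/-- The mean over the hash function of the squared Hilbert-Schmidt norms of the deviation. -/
lemma sum_trace_devBlock_sq_le [Nonempty Z] {P : F → ℝ} {h : F → X → Z}
    (hh : IsTwoUniversal P h) {W : X → C → ℝ} (hW : ∀ x, IsProb (W x)) {m : ℝ}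
    (hm : ∀ x c, W x c ≤ m) {σ : Matrix (X × E) (X × E) ℂ} (hσ : σ.PosSemidef) :
    ∑ i : Z × C × F, P i.2.2 *
      (devBlock W h σ i.2.2 i.2.1 i.1 * devBlock W h σ i.2.2 i.2.1 i.1).trace.re ≤
      m * ∑ x, (block σ x * block σ x).trace.re := by
  -- Two-universality bounds the excess from one side only, so the cross terms can be dropped only
  -- because these traces are nonnegative. Here positivity of `σ` is essential.
  have ht (x y : X) : 0 ≤ (block σ x * block σ y).trace.re :=
    re_trace_mul_nonneg (posSemidef_block hσ x) (posSemidef_block hσ y)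
  have expand (f : F) (c : C) (z : Z) :
      (devBlock W h σ f c z * devBlock W h σ f c z).trace.re =
      ∑ x, ∑ y, devCoeff W h f c z x * devCoeff W h f c z y *
        (block σ x * block σ y).trace.re := by
    rw [devBlock, Finset.sum_mul, trace_sum, Complex.re_sum]
    refine Finset.sum_congr rfl fun x _ => ?_
    rw [Finset.mul_sum, trace_sum, Complex.re_sum]
    refine Finset.sum_congr rfl fun y _ => ?_
    rw [smul_mul_assoc, mul_smul_comm, smul_smul, trace_smul, smul_eq_mul, ← Complex.ofReal_mul,
      Complex.re_ofReal_mul]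
  -- Summing over the key first separates the overlap of the transcripts from the collision excess
  -- of the hash.
  have step (x y : X) : ∑ i : Z × C × F, P i.2.2 *
      (devCoeff W h i.2.2 i.2.1 i.1 x * devCoeff W h i.2.2 i.2.1 i.1 y) =
      (∑ c, W x c * W y c) *
        ∑ f, P f * ((if h f x = h f y then 1 else 0) - 1 / Fintype.card Z) := by
    rw [Fintype.sum_prod_type, Finset.sum_comm, Fintype.sum_prod_type, Finset.sum_mul]
    refine Finset.sum_congr rfl fun c _ => ?_
    rw [Finset.mul_sum]
    refine Finset.sum_congr rfl fun f _ => ?_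
    rw [← sum_indicator_sub_mul, Finset.mul_sum, Finset.mul_sum]
    refine Finset.sum_congr rfl fun z _ => ?_
    simp only [devCoeff]
    ring
  calc _ = ∑ x, ∑ y, (∑ i : Z × C × F, P i.2.2 *
      (devCoeff W h i.2.2 i.2.1 i.1 x * devCoeff W h i.2.2 i.2.1 i.1 y)) *
        (block σ x * block σ y).trace.re := by
        simp only [expand, Finset.mul_sum, Finset.sum_mul]
        rw [Finset.sum_comm]
        refine Finset.sum_congr rfl fun x _ => ?_
        rw [Finset.sum_comm]
        refine Finset.sum_congr rfl fun y _ => Finset.sum_congr rfl fun i _ => ?_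
        ring
    _ ≤ ∑ x, ∑ y, (∑ c, W x c * W y c) * (if x = y then 1 else 0) *
        (block σ x * block σ y).trace.re := by
        refine Finset.sum_le_sum fun x _ => Finset.sum_le_sum fun y _ => ?_
        rw [step]
        refine mul_le_mul_of_nonneg_right (mul_le_mul_of_nonneg_left
          (sum_collision_sub_le hh x y) ?_) (ht x y)
        exact Finset.sum_nonneg fun c _ => mul_nonneg ((hW x).1 c) ((hW y).1 c)
    _ = ∑ x, (∑ c, W x c * W x c) * (block σ x * block σ x).trace.re := by
        refine Finset.sum_congr rfl fun x _ => ?_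
        rw [Finset.sum_eq_single x]
        · simp
        · intro y _ hy
          simp [hy.symm]
        · simp
    _ ≤ ∑ x, m * (block σ x * block σ x).trace.re := by
        refine Finset.sum_le_sum fun x _ => mul_le_mul_of_nonneg_right ?_ (ht x x)
        -- One factor of `W` is bounded by its maximum and the other sums to 1: here the min-entropy
        -- of the transcript enters.
        calc ∑ c, W x c * W x c ≤ ∑ c, m * W x c :=
              Finset.sum_le_sum fun c _ => mul_le_mul_of_nonneg_right (hm x c) ((hW x).1 c)
          _ = m := by rw [← Finset.mul_sum, (hW x).2, mul_one]
    _ = _ := by rw [Finset.mul_sum]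

omit [DecidableEq X] [Fintype E] [DecidableEq E] in
lemma traceFst_eq_sum_block (σ : Matrix (X × E) (X × E) ℂ) : traceFst σ = ∑ x, block σ x := by
  ext a b
  simp [traceFst, block, Matrix.sum_apply]

omit [DecidableEq X] [DecidableEq E] [Fintype C] [DecidableEq C] [Fintype F] [DecidableEq F] in
-- `traceFst σ` is the sum of the positive blocks of `σ`, so a vector in its kernel is killed by
-- every block and hence by any linear combination of them. Rank-nullity turns the inclusion of
-- kernels into the bound.
lemma rank_devBlock_le (W : X → C → ℝ) (h : F → X → Z) {σ : Matrix (X × E) (X × E) ℂ}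
    (hσ : σ.PosSemidef) (f : F) (c : C) (z : Z) :
    (devBlock W h σ f c z).rank ≤ (traceFst σ).rank := by
  have hker : LinearMap.ker (traceFst σ).mulVecLin ≤
      LinearMap.ker (devBlock W h σ f c z).mulVecLin := by
    intro v hv
    rw [LinearMap.mem_ker, mulVecLin_apply, traceFst_eq_sum_block, sum_mulVec] at hv
    have h0 (x : X) : block σ x *ᵥ v = 0 := by
      have hs : ∑ x, star v ⬝ᵥ (block σ x *ᵥ v) = 0 := by
        rw [← dotProduct_sum, hv, dotProduct_zero]
      have := (Finset.sum_eq_zero_iff_of_nonneg fun x _ =>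
        (posSemidef_block hσ x).dotProduct_mulVec_nonneg v).1 hs x (Finset.mem_univ x)
      exact ((posSemidef_block hσ x).dotProduct_mulVec_zero_iff v).1 this
    rw [LinearMap.mem_ker, mulVecLin_apply, devBlock, sum_mulVec]
    exact Finset.sum_eq_zero fun x _ => by rw [smul_mulVec, h0, smul_zero]
  have h1 := LinearMap.finrank_range_add_finrank_ker (traceFst σ).mulVecLin
  have h2 := LinearMap.finrank_range_add_finrank_ker (devBlock W h σ f c z).mulVecLin
  have h3 := Submodule.finrank_mono hker
  simp only [rank]
  omega

omit [DecidableEq C] [DecidableEq F] in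
/-- Privacy amplification by two-universal hashing. -/
lemma sum_traceNorm_devBlock_le_sqrt [Nonempty Z] {P : F → ℝ} {h : F → X → Z}
    (hh : IsTwoUniversal P h) {W : X → C → ℝ} (hW : ∀ x, IsProb (W x)) {m : ℝ}
    (hm : ∀ x c, W x c ≤ m) {σ : Matrix (X × E) (X × E) ℂ} (hσ : σ.PosSemidef) :
    ∑ i : Z × C × F, P i.2.2 * traceNorm (devBlock W h σ i.2.2 i.2.1 i.1) ≤
      √((Fintype.card Z * Fintype.card C) *
        ((traceFst σ).rank * (m * ∑ x, (block σ x * block σ x).trace.re))) := by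
  apply Real.le_sqrt_of_sq_le
  have hP := hh.1.1
  set t : Z × C × F → ℝ := fun i => traceNorm (devBlock W h σ i.2.2 i.2.1 i.1)
  -- Cauchy-Schwarz with weights P(f). The total weight over all (z, c, f) is |Z||C|, the source of
  -- the term log|C| in the leakage.
  have hcs := Finset.sum_sq_le_sum_mul_sum_of_sq_le_mul Finset.univ
    (r := fun i : Z × C × F => P i.2.2 * t i) (f := fun i => P i.2.2)
    (g := fun i => P i.2.2 * t i ^ 2) (fun i _ => hP _)
    (fun i _ => mul_nonneg (hP _) (sq_nonneg _)) (fun i _ => le_of_eq (by ring))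
  have hcard : ∑ i : Z × C × F, P i.2.2 = Fintype.card Z * Fintype.card C := by
    simp [Fintype.sum_prod_type, hh.1.2]
  rw [hcard] at hcs
  refine hcs.trans (mul_le_mul_of_nonneg_left ?_ (by positivity))
  refine le_trans ?_ (mul_le_mul_of_nonneg_left (sum_trace_devBlock_sq_le hh hW hm hσ)
    (Nat.cast_nonneg _))
  rw [Finset.mul_sum]
  refine Finset.sum_le_sum fun i _ => ?_
  rw [mul_left_comm]
  refine mul_le_mul_of_nonneg_left ?_ (hP _)
  have hD := isHermitian_devBlock W h hσ.1 i.2.2 i.2.1 i.1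
  have hnn : 0 ≤ (devBlock W h σ i.2.2 i.2.1 i.1 * devBlock W h σ i.2.2 i.2.1 i.1).trace.re := by
    rw [trace_sq_eq_sum_sq_eigenvalues hD]
    exact Finset.sum_nonneg fun _ _ => sq_nonneg _
  refine (pow_le_pow_left₀ (traceNorm_nonneg hD) (traceNorm_le_sqrt_rank hD) 2).trans ?_
  rw [Real.sq_sqrt (mul_nonneg (Nat.cast_nonneg _) hnn)]
  exact mul_le_mul_of_nonneg_right (by exact_mod_cast rank_devBlock_le W h hσ _ _ _) hnn

end Hash

/-! ### From norms to entropies -/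

section Security

variable {X A : Type*} [Fintype X] [DecidableEq X] [Fintype A]

lemma IsCQ.apply_eq_zero {ρ : Matrix (X × A) (X × A) ℂ} (hρ : IsCQ ρ) (x y : X) (a b : A)
    (hxy : x ≠ y) : ρ (x, a) (y, b) = 0 := by
  obtain ⟨P, τ, -, -, rfl⟩ := hρ
  simp only [Matrix.sum_apply, Matrix.smul_apply, kroneckerMap_apply, proj, single_apply,
    smul_eq_mul]
  refine Finset.sum_eq_zero fun z _ => ?_
  rw [if_neg fun h => hxy (h.1.symm.trans h.2), zero_mul, mul_zero]

lemma IsCQ.isHermitian {ρ : Matrix (X × A) (X × A) ℂ} (hρ : IsCQ ρ) : ρ.IsHermitian := by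
  obtain ⟨P, τ, -, hτ, rfl⟩ := hρ
  refine isHermitian_sum _ fun x => isHermitian_ofReal_smul ?_ _
  rw [IsHermitian, conjTranspose_kronecker, (hτ x).1.1.eq, proj, conjTranspose_single, star_one]

lemma IsCQ.trace_sq {ρ : Matrix (X × A) (X × A) ℂ} (hρ : IsCQ ρ) :
    (ρ * ρ).trace.re = ∑ x, (block ρ x * block ρ x).trace.re := by
  rw [← Complex.re_sum]
  congr 1
  simp only [trace, diag_apply, mul_apply, Fintype.sum_prod_type]
  refine Finset.sum_congr rfl fun x _ => Finset.sum_congr rfl fun a _ => ?_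
  rw [Finset.sum_eq_single x]
  · rfl
  · intro y _ hy
    exact Finset.sum_eq_zero fun b _ => by rw [hρ.apply_eq_zero x y a b hy.symm, zero_mul]
  · simp

omit [DecidableEq X] in
lemma trace_traceFst (ρ : Matrix (X × A) (X × A) ℂ) : (traceFst ρ).trace = ρ.trace := by
  simp only [trace, diag_apply, traceFst, of_apply, Fintype.sum_prod_type]
  exact Finset.sum_comm

/-- With `rank_traceFst_pos`, this keeps the arguments of `Real.logb` positive, so that 2 to the
power of an entropy can be evaluated. -/
lemma IsState.trace_sq_pos {H : Type*} [Fintype H] {ρ : Matrix H H ℂ} (hρ : IsState ρ) :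
    0 < (ρ * ρ).trace.re := by
  have h0 : 0 ≤ (ρᴴ * ρ).trace := (posSemidef_conjTranspose_mul_self ρ).trace_nonneg
  have h1 : (ρᴴ * ρ).trace ≠ 0 := fun h => by
    rw [trace_conjTranspose_mul_self_eq_zero_iff.1 h] at hρ
    simpa using hρ.2
  rw [hρ.1.1.eq] at h0 h1
  exact (Complex.lt_def.1 (lt_of_le_of_ne h0 h1.symm)).1

omit [DecidableEq X] in
lemma rank_traceFst_pos {ρ : Matrix (X × A) (X × A) ℂ} (hρ : ρ.trace = 1) :
    0 < (traceFst ρ).rank := by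
  rw [Nat.pos_iff_ne_zero]
  intro h
  have h0 : (traceFst ρ).mulVecLin = 0 :=
    LinearMap.range_eq_bot.1 (Submodule.finrank_eq_zero.1 h)
  have h1 : traceFst ρ = 0 := by
    classical
    ext i j
    have := congrFun (LinearMap.congr_fun h0 (Pi.single j 1)) i
    simpa using this
  rw [← trace_traceFst, h1] at hρ
  simp at hρ

omit [DecidableEq X] in
lemma le_rpow_neg_iInf_SInfty {C : Type*} [Fintype C] {W : X → C → ℝ} (hW : ∀ x, IsProb (W x))
    (x : X) (c : C) : W x c ≤ 2 ^ (-⨅ x, SInfty (W x)) := by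
  have hle (c : C) : W x c ≤ ⨆ c, W x c := le_ciSup (Finite.bddAbove_range _) c
  -- A distribution of total mass 1 has a positive maximum, so `Real.logb` is not at its default
  -- value at 0.
  have hpos : 0 < ⨆ c, W x c := by
    by_contra hcon
    have h1 : ∑ c, W x c ≤ 0 :=
      Finset.sum_nonpos fun c _ => (hle c).trans (not_lt.1 hcon)
    rw [(hW x).2] at h1
    linarith
  calc W x c ≤ ⨆ c, W x c := hle c
    _ = 2 ^ (-SInfty (W x)) := by
        rw [SInfty, neg_neg, Real.rpow_logb (by norm_num) (by norm_num) hpos]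
    _ ≤ 2 ^ (-⨅ x, SInfty (W x)) := by
        refine Real.rpow_le_rpow_of_exponent_le (by norm_num) (neg_le_neg ?_)
        exact ciInf_le (Finite.bddBelow_range _) x

variable {Z C F : Type*} [DecidableEq A] [Fintype Z] [DecidableEq Z]
  [Fintype C] [DecidableEq C] [Fintype F] [DecidableEq F]

/-- The distance of the final state from an ideal key, in terms of a state near the initial one. -/
lemma traceDist_hashState_le [Nonempty Z] {P : F → ℝ} {h : F → X → Z}
    (hh : IsTwoUniversal P h) {W : X → C → ℝ} (hW : ∀ x, IsProb (W x)) {m : ℝ}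
    (hm : ∀ x c, W x c ≤ m) {ρ σ : Matrix (X × A) (X × A) ℂ} (hρ : IsCQ ρ) {ε : ℝ}
    (hσ : σ ∈ cqBall (ε / 2) ρ) :
    traceDist (hashState P h (withTranscript W ρ))
      (((1 / Fintype.card Z : ℂ) • (1 : Matrix Z Z ℂ)) ⊗ₖ
        traceFst (hashState P h (withTranscript W ρ))) ≤
      ε + 1 / 2 * √((Fintype.card Z * Fintype.card C) *
        ((traceFst σ).rank * (m * (σ * σ).trace.re))) := by
  obtain ⟨hσs, hσc, hd⟩ := hσ
  have hδ : (ρ - σ).IsHermitian := hρ.isHermitian.sub hσc.isHermitian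
  have hδ0 (x y : X) (a b : A) (hxy : x ≠ y) : (ρ - σ) (x, a) (y, b) = 0 := by
    rw [Matrix.sub_apply, hρ.apply_eq_zero x y a b hxy, hσc.apply_eq_zero x y a b hxy, sub_zero]
  -- The deviation is linear in the state, so smoothing can be done block by block.
  have hsplit (f : F) (c : C) (z : Z) :
      devBlock W h ρ f c z = devBlock W h σ f c z + devBlock W h (ρ - σ) f c z := by
    simp only [devBlock, ← Finset.sum_add_distrib, ← smul_add]
    refine Finset.sum_congr rfl fun x _ => ?_
    congr 1
    ext a b
    simp [block]
  have h1 := traceNorm_hashState_sub_ideal_le hh.1.1 h W hρ.isHermitian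
  have h2 := sum_traceNorm_devBlock_le hh.1 h hW hδ
  have h3 := sum_traceNorm_devBlock_le_sqrt hh hW hm hσs.1
  have h4 := sum_traceNorm_block_le hδ hδ0
  rw [← hσc.trace_sq] at h3
  rw [traceDist, ← neg_sub, traceNorm_neg hδ] at hd
  have h5 : ∑ i : Z × C × F, P i.2.2 * traceNorm (devBlock W h ρ i.2.2 i.2.1 i.1) ≤
      ∑ i : Z × C × F, P i.2.2 * traceNorm (devBlock W h σ i.2.2 i.2.1 i.1) +
      ∑ i : Z × C × F, P i.2.2 * traceNorm (devBlock W h (ρ - σ) i.2.2 i.2.1 i.1) := by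
    rw [← Finset.sum_add_distrib]
    refine Finset.sum_le_sum fun i _ => ?_
    rw [hsplit, ← mul_add]
    exact mul_le_mul_of_nonneg_left (traceNorm_add_le (isHermitian_devBlock W h hσs.1.1 _ _ _)
      (isHermitian_devBlock W h hδ _ _ _)) (hh.1.1 _)
  rw [traceDist]
  -- Distance at most ε/2 means ‖ρ - σ‖₁ ≤ ε; the factor 2 of `h2` and the ½ of `traceDist` cancel,
  -- leaving ε.
  linarith

/-- The smooth leftover hash lemma with a public transcript, in terms of entropies. -/
lemma traceDist_hashState_le_rpow [Nonempty Z] [Nonempty X] {P : F → ℝ} {h : F → X → Z}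
    (hh : IsTwoUniversal P h) {W : X → C → ℝ} (hW : ∀ x, IsProb (W x))
    {ρ σ : Matrix (X × A) (X × A) ℂ} (hρ : IsCQ ρ) {ε : ℝ} (hσ : σ ∈ cqBall (ε / 2) ρ) :
    traceDist (hashState P h (withTranscript W ρ))
      (((1 / Fintype.card Z : ℂ) • (1 : Matrix Z Z ℂ)) ⊗ₖ
        traceFst (hashState P h (withTranscript W ρ))) ≤
      ε + 1 / 2 * 2 ^ ((Real.logb 2 (Fintype.card Z) + leak W - (S2 σ - S0 (traceFst σ))) / 2) := by
  refine (traceDist_hashState_le hh hW (le_rpow_neg_iInf_SInfty hW) hρ hσ).trans_eq ?_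
  -- No probability distribution lives on an empty set of transcripts.
  have hC : Nonempty C := by
    by_contra hC
    rw [not_nonempty_iff] at hC
    have := (hW (Classical.arbitrary X)).2
    simp at this
  have hlog {t : ℝ} (ht : 0 < t) : (2 : ℝ) ^ Real.logb 2 t = t :=
    Real.rpow_logb (by norm_num) (by norm_num) ht
  have e : Real.logb 2 (Fintype.card Z) + leak W - (S2 σ - S0 (traceFst σ)) =
      (Real.logb 2 (Fintype.card Z) + Real.logb 2 (Fintype.card C)) +
      (Real.logb 2 (traceFst σ).rank + (-(⨅ x, SInfty (W x)) + Real.logb 2 (σ * σ).trace.re)) := by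
    rw [leak, S2, S0]
    ring
  have h2 : (0 : ℝ) < 2 := by norm_num
  rw [e, Real.sqrt_eq_rpow, div_eq_mul_one_div (_ + _) (2 : ℝ), Real.rpow_mul h2.le, Real.rpow_add h2,
    Real.rpow_add h2, Real.rpow_add h2, Real.rpow_add h2, hlog, hlog, hlog, hlog]
  · exact hσ.1.trace_sq_pos
  · exact_mod_cast rank_traceFst_pos hσ.1.2
  · exact_mod_cast Fintype.card_pos
  · exact_mod_cast Fintype.card_pos

end Security

/-! ### The extended-real hypothesis and the final limit -/

lemma coe_le_of_le_sub_add {s : EReal} {a b c : ℝ} (h : (a : EReal) ≤ s - b + c) :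
    ((a + b - c : ℝ) : EReal) ≤ s := by
  induction s with
  | bot => simp at h
  | top => exact le_top
  | coe s =>
    have h' : a ≤ s - b + c := by exact_mod_cast h
    exact_mod_cast (by linarith : a + b - c ≤ s)

end QKD

theorem theorem1 {n ℓ : ℕ} {E C F : Type*}
    [Fintype E] [DecidableEq E] [Fintype C] [DecidableEq C] [Fintype F] [DecidableEq F]
    (ρ : Matrix ((Fin n → Bool) × E) ((Fin n → Bool) × E) ℂ) (hρ : QKD.IsCQ ρ)
    (W : (Fin n → Bool) → C → ℝ) (hW : ∀ x, QKD.IsProb (W x))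
    (P : F → ℝ) (h : F → (Fin n → Bool) → (Fin ℓ → Bool)) (hh : QKD.IsTwoUniversal P h)
    (εbar εPA : ℝ) (hεbar : 0 ≤ εbar) (hεPA : 0 ≤ εPA)
    (hℓ : ((ℓ : ℝ) : EReal) ≤
      (⨆ σ ∈ QKD.cqBall (εbar / 2) ρ,
          ((QKD.S2 σ - QKD.S0 (QKD.traceFst σ) : ℝ) : EReal))
        - ((QKD.leak W : ℝ) : EReal) + 2 * QKD.log2 (2 * εPA)) :
    QKD.IsSecure (εbar + εPA) (QKD.hashState P h (QKD.withTranscript W ρ)) := by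
  -- For εPA = 0 the right side of the hypothesis is `⊥`, even if the supremum were `⊤`, so no real
  -- ℓ satisfies it.
  rcases hεPA.eq_or_lt with rfl | hpos
  · rw [QKD.log2, if_pos (by simp), EReal.mul_bot_of_pos (by norm_num), EReal.add_bot,
      le_bot_iff] at hℓ
    exact absurd hℓ (EReal.coe_ne_bot _)
  have h2ε : 0 < 2 * εPA := by positivity
  have h2L : (2 : EReal) * (Real.logb 2 (2 * εPA) : ℝ) = ((2 * Real.logb 2 (2 * εPA) : ℝ) : EReal) :=
    by norm_cast
  rw [QKD.log2, if_neg (not_le.2 h2ε), h2L] at hℓ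
  replace hℓ := QKD.coe_le_of_le_sub_add hℓ
  -- The supremum need not be attained. A σ within 2η of the required value exists, and the loss is
  -- a factor 2^η on εPA, which tends to 1 as η decreases to 0.
  have key (η : ℝ) (hη : 0 < η) :
      QKD.traceDist (QKD.hashState P h (QKD.withTranscript W ρ))
        (((1 / 2 ^ ℓ : ℂ) • (1 : Matrix (Fin ℓ → Bool) (Fin ℓ → Bool) ℂ)) ⊗ₖ
          QKD.traceFst (QKD.hashState P h (QKD.withTranscript W ρ))) ≤
        εbar + εPA * 2 ^ η := by
    have hlt : (((ℓ : ℝ) + QKD.leak W - 2 * Real.logb 2 (2 * εPA) - 2 * η : ℝ) : EReal) <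
        ⨆ σ ∈ QKD.cqBall (εbar / 2) ρ, ((QKD.S2 σ - QKD.S0 (QKD.traceFst σ) : ℝ) : EReal) :=
      lt_of_lt_of_le (EReal.coe_lt_coe_iff.2 (by linarith)) hℓ
    simp only [lt_iSup_iff] at hlt
    obtain ⟨σ, hσ, hlt⟩ := hlt
    replace hlt := EReal.coe_lt_coe_iff.1 hlt
    have hmain := QKD.traceDist_hashState_le_rpow hh hW hρ hσ
    have hcard : Real.logb 2 (Fintype.card (Fin ℓ → Bool) : ℝ) = ℓ := by
      simp [Real.logb_pow]
    have hcard' : (Fintype.card (Fin ℓ → Bool) : ℂ) = 2 ^ ℓ := by simp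
    rw [hcard, hcard'] at hmain
    refine hmain.trans (add_le_add_right ?_ _)
    calc 1 / 2 * (2 : ℝ) ^ (((ℓ : ℝ) + QKD.leak W - (QKD.S2 σ - QKD.S0 (QKD.traceFst σ))) / 2)
        ≤ 1 / 2 * (2 : ℝ) ^ (Real.logb 2 (2 * εPA) + η) := by
          refine mul_le_mul_of_nonneg_left
            (Real.rpow_le_rpow_of_exponent_le (by norm_num) (by linarith)) (by norm_num)
      _ = εPA * 2 ^ η := by
          rw [Real.rpow_add (by norm_num), Real.rpow_logb (by norm_num) (by norm_num) h2ε]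
          ring
  have hlim : Filter.Tendsto (fun η : ℝ => εbar + εPA * (2 : ℝ) ^ η)
      (nhdsWithin 0 (Set.Ioi 0)) (nhds (εbar + εPA)) := by
    have hc : Continuous fun η : ℝ => εbar + εPA * (2 : ℝ) ^ η :=
      continuous_const.add (continuous_const.mul
        (Real.continuous_const_rpow (by norm_num)))
    have := hc.tendsto 0
    simp only [Real.rpow_zero, mul_one] at this
    exact this.mono_left nhdsWithin_le_nhds
  exact ge_of_tendsto hlim (Filter.eventually_of_mem self_mem_nhdsWithin fun η hη => key η hη)
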